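/- Let $\mathcal{C}$ be a variety of algebras, that is, the category of all algebras (sets with finitary operations) over a fixed signature that satisfy a fixed set of equational laws, with all homomorphisms between them. Suppose that $\mathcal{C}$ is (algebraically) universal: it contains a full subcategory that is equivalent to the category of directed graphs (sets with a binary relation, and maps that preserve the relation). Then there is an algebra $A$ in $\mathcal{C}$ with the following four properties, whose monoid of endomorphisms does not have commuting idempotents (there are idempotent endomorphisms $e, f$ of $A$ with $ef \neq fe$). (RI) The intersection of two retracts of $A$ is a retract: if $A_1 \hookrightarrow A$ and $A_2 \hookrightarrow A$ admit retractions (left inverses in $\mathcal{C}$), then so does the inclusion $A_3 \hookrightarrow A$ of their pullback $A_3 = A_1 \times_A A_2$. (RI*) The join of two coretracts of $A$ is a coretract: if $A \twoheadrightarrow A_1$ and $A \twoheadrightarrow A_2$ admit sections (right inverses in $\mathcal{C}$), then so does the map $A \twoheadrightarrow A_3$ to their pushout $A_3 = A_1 \sqcup_A A_2$. (UR) Each retract $R \hookrightarrow A$ has a unique left inverse $A \twoheadrightarrow R$. (UR*) Each coretract $A \twoheadrightarrow R$ has a unique section $R \hookrightarrow A$. -/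

import Mathlib

open CategoryTheory FirstOrder

universe u v w w' z

/-- A directed graph: a set of vertices with an arbitrary binary relation (loops are allowed). -/
structure DigraphCat : Type (u + 1) where
  /-- the vertices -/
  Vertex : Type u
  /-- the edge relation -/
  graph : Digraph Vertex

namespace DigraphCat

/-- Homomorphisms of directed graphs: maps on vertices that send edges to edges. -/
@[ext]
structure Hom (G H : DigraphCat.{u}) : Type u where
  /-- the map on vertices -/
  toFun : G.Vertex → H.Vertex
  map_adj : ∀ x y, G.graph.Adj x y → H.graph.Adj (toFun x) (toFun y)

/-- The category of directed graphs. -/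
instance : Category.{u} DigraphCat.{u} where
  Hom G H := Hom G H
  id G := ⟨fun x => x, fun _ _ h => h⟩
  comp f g := ⟨fun x => g.toFun (f.toFun x), fun _ _ h => g.map_adj _ _ (f.map_adj _ _ h)⟩

end DigraphCat

/-- The algebras of the variety given by the signature `L` (a language, to be used only when it
has no relation symbols) and the set `E` of equational laws between terms in the variables
`x₀, x₁, …`: sets with an interpretation of every operation symbol for which each law in `E`
holds under every assignment of the variables. The empty algebra is allowed. -/
structure VarietyAlg (L : FirstOrder.Language.{w, w'}) (E : Set (L.Term ℕ × L.Term ℕ)) where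
  /-- the underlying set -/
  carrier : Type u
  /-- the operations -/
  [str : L.Structure carrier]
  laws : ∀ p ∈ E, ∀ a : ℕ → carrier, p.1.realize a = p.2.realize a

namespace VarietyAlg

variable {L : FirstOrder.Language.{w, w'}} {E : Set (L.Term ℕ × L.Term ℕ)}

attribute [instance] VarietyAlg.str

/-- The category of all algebras in a variety, with all homomorphisms between them. -/
instance : Category.{u} (VarietyAlg.{u} L E) where
  Hom A B := A.carrier →[L] B.carrier
  id A := FirstOrder.Language.Hom.id L A.carrier
  comp f g := FirstOrder.Language.Hom.comp g f

end VarietyAlg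

section Properties

variable {C : Type z} [Category.{v} C]

/-- (Algebraically) universal: some full subcategory is equivalent to the category of directed
graphs. -/
def IsUniversalCategory (C : Type z) [Category.{v} C] : Prop :=
  ∃ P : ObjectProperty C, Nonempty (P.FullSubcategory ≌ DigraphCat.{u})

/-- (RI): if `A₁ ↪ A` and `A₂ ↪ A` admit retractions, then so does the inclusion into `A` of
their pullback (that is, of their intersection). -/
def PropertyRI (A : C) : Prop :=
  ∀ (A₁ A₂ : C) (i₁ : A₁ ⟶ A) (i₂ : A₂ ⟶ A), IsSplitMono i₁ → IsSplitMono i₂ →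
    ∃ (A₃ : C) (p₁ : A₃ ⟶ A₁) (p₂ : A₃ ⟶ A₂), IsPullback p₁ p₂ i₁ i₂ ∧ IsSplitMono (p₁ ≫ i₁)

/-- (UR): every retract `R ↪ A` has a unique left inverse `A ↠ R`. -/
def PropertyUR (A : C) : Prop :=
  ∀ (R : C) (i : R ⟶ A), IsSplitMono i → ∃! r : A ⟶ R, i ≫ r = 𝟙 R

/-- (RI*): if `A ↠ A₁` and `A ↠ A₂` admit sections, then so does the map from `A` to their
pushout. -/
def PropertyRIStar (A : C) : Prop :=
  ∀ (A₁ A₂ : C) (r₁ : A ⟶ A₁) (r₂ : A ⟶ A₂), IsSplitEpi r₁ → IsSplitEpi r₂ →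
    ∃ (A₃ : C) (q₁ : A₁ ⟶ A₃) (q₂ : A₂ ⟶ A₃), IsPushout r₁ r₂ q₁ q₂ ∧ IsSplitEpi (r₁ ≫ q₁)

/-- (UR*): every coretract `A ↠ R` has a unique section `R ↪ A`. -/
def PropertyURStar (A : C) : Prop :=
  ∀ (R : C) (r : A ⟶ R), IsSplitEpi r → ∃! i : R ⟶ A, i ≫ r = 𝟙 R

end Properties

/-- All idempotents of the monoid `S` commute with each other. -/
def HasCommutingIdempotents (S : Type v) [Monoid S] : Prop :=
  ∀ e f : S, IsIdempotentElem e → IsIdempotentElem f → e * f = f * e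

/-! ### Objects whose idempotent endomorphisms satisfy `e ≫ f ≫ e = f ≫ e ≫ f` -/

section IdempotentsBraid

variable {C : Type z} [Category.{v} C]

/-! Commutativity of idempotents can be weakened to `e ≫ f ≫ e = f ≫ e ≫ f`: this element is still
an idempotent absorbing `e` and `f` on both sides. Where idempotents split, as in any variety, its
splitting gives both the intersection of two retracts and the join of two coretracts
(`exists_split_meet`), while uniqueness follows from the relation alone. The relation lives in the
endomorphism monoid, so it passes along the full embedding of digraphs, and one finite digraph with
braiding, non-commuting idempotents suffices. -/

/-- Any two idempotent endomorphisms `e`, `f` of `A` satisfy `e ≫ f ≫ e = f ≫ e ≫ f`. -/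
def IdempotentsBraid (A : C) : Prop :=
  ∀ e f : A ⟶ A, e ≫ e = e → f ≫ f = f → e ≫ f ≫ e = f ≫ e ≫ f

lemma comp_idem_of_section_retraction {A R : C} {i : R ⟶ A} {r : A ⟶ R} (h : i ≫ r = 𝟙 R) :
    (r ≫ i) ≫ (r ≫ i) = r ≫ i := by
  rw [Category.assoc, reassoc_of% h]

namespace IdempotentsBraid

variable {A : C}

/-- Idempotents satisfying the braid relation have a meet, which absorbs both of them and is
itself split when idempotents of `C` split. -/
lemma exists_split_meet [IsIdempotentComplete C] (h : IdempotentsBraid A) {e f : A ⟶ A}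
    (he : e ≫ e = e) (hf : f ≫ f = f) :
    ∃ (Y : C) (j : Y ⟶ A) (q : A ⟶ Y), j ≫ q = 𝟙 Y ∧ q ≫ j = e ≫ f ≫ e ∧
      j ≫ e = j ∧ j ≫ f = j ∧ e ≫ q = q ∧ f ≫ q = q := by
  have hk := h e f he hf
  have hek : e ≫ e ≫ f ≫ e = e ≫ f ≫ e := by rw [reassoc_of% he]
  have hfk : f ≫ e ≫ f ≫ e = e ≫ f ≫ e := by rw [hk, reassoc_of% hf]
  have hke : (e ≫ f ≫ e) ≫ e = e ≫ f ≫ e := by simp only [Category.assoc, he]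
  have hkf : (e ≫ f ≫ e) ≫ f = e ≫ f ≫ e := by rw [hk]; simp only [Category.assoc, hf]
  have hkk : (e ≫ f ≫ e) ≫ (e ≫ f ≫ e) = e ≫ f ≫ e := by
    rw [← Category.assoc, hke, ← Category.assoc, hkf, hke]
  obtain ⟨Y, j, q, hjq, hqj⟩ := IsIdempotentComplete.idempotents_split A _ hkk
  have hj : j = j ≫ (e ≫ f ≫ e) := by rw [← hqj, reassoc_of% hjq]
  have hq : q = (e ≫ f ≫ e) ≫ q := by rw [← hqj, Category.assoc, hjq, Category.comp_id]
  refine ⟨Y, j, q, hjq, hqj, ?_, ?_, ?_, ?_⟩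
  · rw [hj, Category.assoc, hke]
  · rw [hj, Category.assoc, hkf]
  · rw [hq, ← Category.assoc, hek]
  · rw [hq, ← Category.assoc, hfk]

/-- For two retractions `r`, `s` of `i`, the braid relation for `r ≫ i` and `s ≫ i` collapses to `r
≫ i = s ≫ i`. -/
lemma propertyUR (h : IdempotentsBraid A) : PropertyUR A := by
  rintro R i ⟨⟨⟨r, hr⟩⟩⟩
  refine ⟨r, hr, fun s (hs : i ≫ s = 𝟙 R) => ?_⟩
  have key := h (r ≫ i) (s ≫ i) (comp_idem_of_section_retraction hr)
    (comp_idem_of_section_retraction hs)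
  have := congr($key ≫ r)
  simpa [reassoc_of% hr, reassoc_of% hs, hr] using this.symm

lemma propertyURStar (h : IdempotentsBraid A) : PropertyURStar A := by
  rintro R r ⟨⟨⟨i, hi⟩⟩⟩
  refine ⟨i, hi, fun s (hs : s ≫ r = 𝟙 R) => ?_⟩
  have key := h (r ≫ i) (r ≫ s) (comp_idem_of_section_retraction hi)
    (comp_idem_of_section_retraction hs)
  have := congr(i ≫ $key)
  simpa [reassoc_of% hi, reassoc_of% hs] using this.symm

lemma propertyRI [IsIdempotentComplete C] (h : IdempotentsBraid A) : PropertyRI A := by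
  rintro A₁ A₂ i₁ i₂ ⟨⟨⟨r₁, h₁⟩⟩⟩ ⟨⟨⟨r₂, h₂⟩⟩⟩
  obtain ⟨Y, j, q, hjq, hqj, hj₁, hj₂, -, -⟩ := h.exists_split_meet
    (comp_idem_of_section_retraction h₁) (comp_idem_of_section_retraction h₂)
  have e₁ : (j ≫ r₁) ≫ i₁ = j := by rw [Category.assoc, hj₁]
  have e₂ : (j ≫ r₂) ≫ i₂ = j := by rw [Category.assoc, hj₂]
  -- A map into `A` factoring through both retracts is fixed by both idempotents, hence by their
  -- meet.
  have absorb {T : C} (a : T ⟶ A₁) (b : T ⟶ A₂) (hs : a ≫ i₁ = b ≫ i₂) :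
      a ≫ i₁ ≫ q ≫ j = a ≫ i₁ := by
    simp only [hqj, Category.assoc, reassoc_of% h₁]
    rw [reassoc_of% hs, reassoc_of% h₂, ← reassoc_of% hs, reassoc_of% h₁]
  refine ⟨Y, j ≫ r₁, j ≫ r₂, ⟨⟨e₁.trans e₂.symm⟩, ⟨Limits.PullbackCone.IsLimit.mk _
    (fun s => s.fst ≫ i₁ ≫ q) (fun s => ?_) (fun s => ?_) (fun s m hm _ => ?_)⟩⟩,
    ⟨⟨⟨q, by rw [e₁, hjq]⟩⟩⟩⟩
  · have := congr($(absorb s.fst s.snd s.condition) ≫ r₁)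
    simpa [h₁] using this
  · have := congr($(absorb s.fst s.snd s.condition) ≫ r₂)
    simp only [Category.assoc] at this
    simp only [Category.assoc]
    rw [this, s.condition_assoc, h₂, Category.comp_id]
  · rw [← hm, Category.assoc m, ← Category.assoc (j ≫ r₁), e₁, hjq, Category.comp_id]

lemma propertyRIStar [IsIdempotentComplete C] (h : IdempotentsBraid A) : PropertyRIStar A := by
  rintro A₁ A₂ r₁ r₂ ⟨⟨⟨i₁, h₁⟩⟩⟩ ⟨⟨⟨i₂, h₂⟩⟩⟩
  obtain ⟨Y, j, q, hjq, hqj, -, -, hq₁, hq₂⟩ := h.exists_split_meet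
    (comp_idem_of_section_retraction h₁) (comp_idem_of_section_retraction h₂)
  have e₁ : r₁ ≫ i₁ ≫ q = q := by rw [← Category.assoc, hq₁]
  have e₂ : r₂ ≫ i₂ ≫ q = q := by rw [← Category.assoc, hq₂]
  have absorb {T : C} (a : A₁ ⟶ T) (b : A₂ ⟶ T) (hs : r₁ ≫ a = r₂ ≫ b) :
      q ≫ j ≫ r₁ ≫ a = r₁ ≫ a := by
    rw [reassoc_of% hqj]
    simp only [reassoc_of% h₁]
    rw [hs, reassoc_of% h₂, ← hs, reassoc_of% h₁]
  refine ⟨Y, i₁ ≫ q, i₂ ≫ q, ⟨⟨e₁.trans e₂.symm⟩, ⟨Limits.PushoutCocone.IsColimit.mk _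
    (fun s => j ≫ r₁ ≫ s.inl) (fun s => ?_) (fun s => ?_) (fun s m hm _ => ?_)⟩⟩,
    ⟨⟨⟨j, by rw [e₁, hjq]⟩⟩⟩⟩
  · rw [Category.assoc, absorb s.inl s.inr s.condition, reassoc_of% h₁]
  · rw [Category.assoc, absorb s.inl s.inr s.condition, s.condition, reassoc_of% h₂]
  · rw [← hm, Category.assoc i₁, reassoc_of% e₁, reassoc_of% hjq]

/-- Pullbacks and pushouts need not be preserved by `F`, but equations between endomorphisms are
preserved and reflected. -/
lemma of_fullyFaithful {D : Type w} [Category.{w'} D] {F : D ⥤ C} (hF : F.FullyFaithful) {G : D}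
    (h : IdempotentsBraid G) : IdempotentsBraid (F.obj G) := by
  intro e f he hf
  obtain ⟨e, rfl⟩ := hF.map_surjective e
  obtain ⟨f, rfl⟩ := hF.map_surjective f
  simp only [← F.map_comp] at he hf ⊢
  rw [h e f (hF.map_injective he) (hF.map_injective hf)]

end IdempotentsBraid

end IdempotentsBraid

/-! ### Idempotents split in a variety -/

namespace VarietyAlg

variable {L : FirstOrder.Language.{w, w'}} {E : Set (L.Term ℕ × L.Term ℕ)}

/-- A substructure of an algebra in a variety is an algebra in the variety. -/
def ofSubstructure (A : VarietyAlg.{u} L E) (S : L.Substructure A.carrier) :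
    VarietyAlg.{u} L E where
  carrier := S
  laws p hp a := by
    apply S.subtype.injective
    rw [← Language.HomClass.realize_term, ← Language.HomClass.realize_term]
    exact A.laws p hp _

instance : IsIdempotentComplete (VarietyAlg.{u} L E) where
  idempotents_split A p hp := by
    have hpp : ∀ x : A.carrier, p.toFun (p.toFun x) = p.toFun x := fun x =>
      congrArg (fun g : A.carrier →[L] A.carrier => g x) hp
    -- The fixed points of `p` form a subalgebra, which is also its image.
    let S : L.Substructure A.carrier :=
      Language.Hom.eqLocus (M := A.carrier) (N := A.carrier) p (Language.Hom.id L A.carrier)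
    let i : S →[L] A.carrier := S.subtype.toHom
    let r : A.carrier →[L] S :=
      { toFun := fun x => ⟨p.toFun x, hpp x⟩
        map_fun' := fun f x => Subtype.ext (p.map_fun' f x)
        map_rel' := fun R x hx => p.map_rel' R x hx }
    refine ⟨A.ofSubstructure S, i, r, ?_, ?_⟩
    · exact Language.Hom.ext (M := S) (N := S) fun x => Subtype.ext x.2
    · exact Language.Hom.ext (M := A.carrier) (N := A.carrier) fun x => rfl

end VarietyAlg

/-! ### A digraph on four vertices whose idempotents braid without commuting -/

namespace DigraphCat

/-- The edges of `braidDigraph`. -/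
def braidAdj (x y : Fin 4) : Prop :=
  (x, y) ∈ ([(0, 0), (0, 2), (0, 3), (1, 2), (1, 3), (2, 1)] : List (Fin 4 × Fin 4))

instance : DecidableRel braidAdj := fun _ _ => inferInstanceAs (Decidable (_ ∈ _))

/-- A digraph on four vertices with idempotent endomorphisms that do not commute. -/
def braidDigraph : DigraphCat.{u} where
  Vertex := ULift.{u} (Fin 4)
  graph := ⟨fun x y => braidAdj x.down y.down⟩

/-- The only loop, 0, is fixed. The 2-cycle on 1 and 2 is either fixed pointwise or collapsed to 0;
as 0 and 1 both point to 3, this leaves two images for 3 in each case. -/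
lemma braidAdj_idempotent : ∀ a : Fin 4 → Fin 4, (∀ x y, braidAdj x y → braidAdj (a x) (a y)) →
    (∀ x, a (a x) = a x) →
      a = ![0, 0, 0, 0] ∨ a = ![0, 0, 0, 3] ∨ a = ![0, 1, 2, 2] ∨ a = ![0, 1, 2, 3] := by
  decide +kernel

lemma braidAdj_idempotents_braid (a b : Fin 4 → Fin 4)
    (ha : ∀ x y, braidAdj x y → braidAdj (a x) (a y)) (haa : ∀ x, a (a x) = a x)
    (hb : ∀ x y, braidAdj x y → braidAdj (b x) (b y)) (hbb : ∀ x, b (b x) = b x) :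
    ∀ x, a (b (a x)) = b (a (b x)) := by
  rcases braidAdj_idempotent a ha haa with rfl | rfl | rfl | rfl <;>
  rcases braidAdj_idempotent b hb hbb with rfl | rfl | rfl | rfl <;> decide

/-- The endomorphism of `braidDigraph` given by a map on `Fin 4`. -/
def braidDigraphHom (a : Fin 4 → Fin 4) (ha : ∀ x y, braidAdj x y → braidAdj (a x) (a y)) :
    braidDigraph.{u} ⟶ braidDigraph.{u} :=
  Hom.mk (fun x => ⟨a x.down⟩) fun x y h => ha x.down y.down h

lemma idempotentsBraid_braidDigraph : IdempotentsBraid braidDigraph.{u} := by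
  intro e f he hf
  have hom (g : braidDigraph.{u} ⟶ braidDigraph.{u}) :
      ∀ x y, braidAdj x y → braidAdj (g.toFun ⟨x⟩).down (g.toFun ⟨y⟩).down :=
    fun x y h => g.map_adj ⟨x⟩ ⟨y⟩ h
  have idem {g : braidDigraph.{u} ⟶ braidDigraph.{u}} (hg : g ≫ g = g) :
      ∀ x, (g.toFun ⟨(g.toFun ⟨x⟩).down⟩).down = (g.toFun ⟨x⟩).down :=
    fun x => congrArg (fun k : Hom braidDigraph.{u} braidDigraph.{u} => (k.toFun ⟨x⟩).down) hg
  have key := braidAdj_idempotents_braid _ _ (hom e) (idem he) (hom f) (idem hf)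
  exact Hom.ext (funext fun x => ULift.ext _ _ (key x.down))

/-- One map collapses 1 and 2 to 0 and fixes 3; the other folds 3 onto 2, which has the same
in-neighbours. The order decides whether 3 ends at 2 or at 0. -/
lemma exists_idempotents_not_commute : ∃ e f : braidDigraph.{u} ⟶ braidDigraph.{u},
    e ≫ e = e ∧ f ≫ f = f ∧ e ≫ f ≠ f ≫ e := by
  refine ⟨braidDigraphHom ![0, 0, 0, 3] (by decide), braidDigraphHom ![0, 1, 2, 2] (by decide),
    Hom.ext (funext fun x => ULift.ext _ _ ?_), Hom.ext (funext fun x => ULift.ext _ _ ?_),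
    fun h => ?_⟩
  · exact (by decide : ∀ x : Fin 4, (![0, 0, 0, 3] : Fin 4 → Fin 4)
      ((![0, 0, 0, 3] : Fin 4 → Fin 4) x) = (![0, 0, 0, 3] : Fin 4 → Fin 4) x) x.down
  · exact (by decide : ∀ x : Fin 4, (![0, 1, 2, 2] : Fin 4 → Fin 4)
      ((![0, 1, 2, 2] : Fin 4 → Fin 4) x) = (![0, 1, 2, 2] : Fin 4 → Fin 4) x) x.down
  · have h3 : (2 : Fin 4) = 0 :=
      congrArg (fun k : Hom braidDigraph.{u} braidDigraph.{u} => (k.toFun ⟨3⟩).down) h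
    exact absurd h3 (by decide)

end DigraphCat

theorem proposition4p5 (L : FirstOrder.Language.{w, w'}) [L.IsAlgebraic]
    (E : Set (L.Term ℕ × L.Term ℕ))
    (hC : IsUniversalCategory.{u} (VarietyAlg.{u} L E)) :
    ∃ A : VarietyAlg.{u} L E,
      PropertyRI A ∧ PropertyRIStar A ∧ PropertyUR A ∧ PropertyURStar A ∧
        ¬ HasCommutingIdempotents (End A) := by
  obtain ⟨P, ⟨eqv⟩⟩ := hC
  let F : DigraphCat.{u} ⥤ VarietyAlg.{u} L E := eqv.inverse ⋙ P.ι
  have hF : F.FullyFaithful := eqv.fullyFaithfulInverse.comp P.fullyFaithfulι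
  have hA := DigraphCat.idempotentsBraid_braidDigraph.of_fullyFaithful hF
  refine ⟨F.obj DigraphCat.braidDigraph, hA.propertyRI, hA.propertyRIStar, hA.propertyUR,
    hA.propertyURStar, fun hcomm => ?_⟩
  obtain ⟨e, f, he, hf, hef⟩ := DigraphCat.exists_idempotents_not_commute.{u}
  -- Multiplication in `End` is composition in the reverse order.
  have hcomm' : F.map f ≫ F.map e = F.map e ≫ F.map f :=
    hcomm (F.map e) (F.map f) ((F.map_comp e e).symm.trans (congrArg F.map he))
      ((F.map_comp f f).symm.trans (congrArg F.map hf))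
  rw [← F.map_comp, ← F.map_comp] at hcomm'
  exact hef (hF.map_injective hcomm').symm
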